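/- Let $I=[0,\infty)$ or $I=[0,T]$ with $0<T<\infty$, and let $S$ be a metrizable co-Souslin space, i.e. a topological space homeomorphic to the complement of an analytic subset of a compact metrizable space. Let $D(I;S)$ be the space of càdlàg paths $\omega\colon I\to S$ with the Skorohod ($J_1$) topology and its Borel $\sigma$-algebra, let $Z_t(\omega)=\omega(t)$ be the coordinate process, and let $Z_{t-}(\omega)$ be the left limit of $\omega$ at $t$ (with $Z_{0-}=Z_0$). Let $P$ be a Borel probability measure on $D(I;S)$ and let $f\colon I\times S\to\mathbb{R}$ be Borel measurable. Call $f$ *$P$-quasi continuous* if there is an increasing sequence $(K_n)_{n\in\mathbb{N}}$ of compact subsets of $I\times S$ such that $$P\big[(s,Z_s)\notin K_n \text{ for some } s\in[0,n]\cap I\big]\longrightarrow 0\quad\text{as } n\to\infty,$$ and such that the restriction of $f$ to each $K_n$ is continuous. Then the following two conditions are equivalent. 1. $f$ is $P$-quasi continuous. 2. $P$-almost surely, the path $t\mapsto f(t,Z_t)$, $t\in I$, is càdlàg (right continuous with left limits in $\mathbb{R}$), and, $P$-almost surely, the path $t\mapsto f(t,Z_{t-})$, $t\in I$, is càglàd (left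 continuous with right limits in $\mathbb{R}$). -/

import Mathlib

open Set Filter Topology MeasureTheory

universe u

/-- A function on a set `I` of times is càdlàg if at every `t ∈ I` it is right continuous and has a
left limit. All limits are taken within `I`, so that there is no condition from the left at the
first point of `I` and none from the right at the last point. -/
def IsCadlag {I : Set ℝ} {E : Type*} [TopologicalSpace E] (x : I → E) : Prop :=
  ∀ t : I, Tendsto x (𝓝[>] t) (𝓝 (x t)) ∧ ∃ l : E, Tendsto x (𝓝[<] t) (𝓝 l)

/-- A function on a set `I` of times is càglàd if at every `t ∈ I` it is left continuous and has a
right limit (limits within `I`). -/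
def IsCaglad {I : Set ℝ} {E : Type*} [TopologicalSpace E] (x : I → E) : Prop :=
  ∀ t : I, Tendsto x (𝓝[<] t) (𝓝 (x t)) ∧ ∃ l : E, Tendsto x (𝓝[>] t) (𝓝 l)

/-- The set `D(I; S)` of càdlàg paths `I → S`. -/
@[ext]
structure SkorohodSpace (I : Set ℝ) (S : Type*) [TopologicalSpace S] where
  toFun : I → S
  isCadlag : IsCadlag toFun

namespace SkorohodSpace

instance {I : Set ℝ} {S : Type*} [TopologicalSpace S] :
    CoeFun (SkorohodSpace I S) (fun _ => I → S) :=
  ⟨SkorohodSpace.toFun⟩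

/-- The basic Skorohod neighbourhood of a path `ω`: the paths `ω'` that are uniformly `ε`-close
to `ω` up to time `N`, after an increasing bijective time change `l` of `I` that differs by less
than `ε` from the identity up to time `N`. -/
def basicNhd {I : Set ℝ} {S : Type*} [PseudoMetricSpace S] (ω : SkorohodSpace I S) (N : ℕ)
    (ε : ℝ) : Set (SkorohodSpace I S) :=
  {ω' | ∃ l : I ≃o I, ∀ t : I, (t : ℝ) ≤ N → dist (l t) t < ε ∧ dist (ω' t) (ω (l t)) < ε}

theorem basicNhd_mono {I : Set ℝ} {S : Type*} [PseudoMetricSpace S] (ω : SkorohodSpace I S)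
    {M N : ℕ} (hMN : M ≤ N) {δ ε : ℝ} (hεδ : ε ≤ δ) : basicNhd ω N ε ⊆ basicNhd ω M δ := by
  rintro ω' ⟨l, hl⟩
  refine ⟨l, fun t ht => ?_⟩
  have h := hl t (ht.trans (by exact_mod_cast hMN))
  exact ⟨h.1.trans_le hεδ, h.2.trans_le hεδ⟩

/-- The Skorohod (`J₁`) topology. For `I = [0, T]` only `N ≥ T` matters and the time changes are
controlled on all of `I`; for `I = [0, ∞)` one gets locally uniform control. The topology depends on
the metric of `S` only through the topology of `S`. -/
instance {I : Set ℝ} {S : Type*} [PseudoMetricSpace S] : TopologicalSpace (SkorohodSpace I S) where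
  IsOpen U := ∀ ω ∈ U, ∃ N : ℕ, ∃ ε : ℝ, 0 < ε ∧ basicNhd ω N ε ⊆ U
  isOpen_univ := fun _ _ => ⟨0, 1, one_pos, subset_univ _⟩
  isOpen_inter := by
    rintro U V hU hV ω ⟨h1, h2⟩
    obtain ⟨M, δ, hδ, hM⟩ := hU ω h1
    obtain ⟨N, ε, hε, hN⟩ := hV ω h2
    exact ⟨max M N, min δ ε, lt_min hδ hε, subset_inter
      ((basicNhd_mono ω (le_max_left _ _) (min_le_left _ _)).trans hM)
      ((basicNhd_mono ω (le_max_right _ _) (min_le_right _ _)).trans hN)⟩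
  isOpen_sUnion := by
    rintro 𝒰 h𝒰 ω ⟨U, hU, hω⟩
    obtain ⟨N, ε, hε, hN⟩ := h𝒰 U hU ω hω
    exact ⟨N, ε, hε, hN.trans (subset_sUnion_of_mem hU)⟩

/-- `D(I; S)` carries the Borel σ-algebra of the Skorohod topology. -/
instance {I : Set ℝ} {S : Type*} [PseudoMetricSpace S] : MeasurableSpace (SkorohodSpace I S) :=
  borel _

instance {I : Set ℝ} {S : Type*} [PseudoMetricSpace S] : BorelSpace (SkorohodSpace I S) :=
  ⟨rfl⟩

end SkorohodSpace

/-- A (metrizable) space is co-Souslin if it is homeomorphic to the complement of an analytic subset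
of a compact metrizable space. -/
def IsCoSouslin (S : Type u) [TopologicalSpace S] : Prop :=
  ∃ (K : Type u) (_ : TopologicalSpace K) (_ : CompactSpace K)
    (_ : TopologicalSpace.MetrizableSpace K) (e : S → K),
    IsEmbedding e ∧ AnalyticSet (range e)ᶜ

/-- `f` is `P`-quasi continuous: there are compact sets `K 0 ⊆ K 1 ⊆ ⋯` in `I × S` such that the
restriction of `f` to each of them is continuous and the `P`-probability that `(s, Z_s) ∉ K n` for
some `s ∈ [0, n] ∩ I` tends to zero. -/
def QuasiContinuous {I : Set ℝ} {S : Type*} [PseudoMetricSpace S]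
    (P : Measure (SkorohodSpace I S)) (f : I × S → ℝ) : Prop :=
  ∃ K : ℕ → Set (I × S), Monotone K ∧ (∀ n, IsCompact (K n)) ∧
    Tendsto (fun n : ℕ => P {ω | ∃ s : I, (s : ℝ) ≤ n ∧ (s, ω s) ∉ K n}) atTop (𝓝 0) ∧
    ∀ n, ContinuousOn f (K n)

/-!
Quasi continuity gives regular paths pathwise: almost surely, for arbitrarily large `n`, the points
`(s, ω s)` with `s ≤ n` lie in the compact set `K n`, hence so do the points `(s, ω (s-))`, and the
one-sided limits of `f` along both of them follow from continuity of `f` on `K n`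
(`isCadlag_and_isCaglad_of_continuousOn`).

For the converse, composing with `arctan` makes `f` bounded. Embed `S` in a compact metrizable space
`K` with analytic complement. The path `X t = (t, ω t, f (t, ω t))` in `I × K × ℝ` is almost surely
right continuous, with left limits `(t, ω (t-), f (t, ω (t-)))`: at continuity points of `ω`, which
are dense by Baire's theorem, the two functions in the hypothesis agree, so their left limits agree
everywhere (`tendsto_comp_nhdsLT_leftLim`). Thus the closure `R` of the path up to time `n` is a
random closed subset of the graph of `f`. The complement `A` of this graph in `I × K × ℝ` is analytic
(`analyticSet_compl_range_graph`), and `R` almost surely avoids `A`. By Choquet's capacitability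
theorem applied to the hitting capacity of `R`, there is an open set `U ⊇ A` that `R` hits with
probability less than `ε` only (`exists_isOpen_superset_hitProb_lt`). Up to time `n`, the complement
of `U` is a compact part of the graph of `f`. So its projection to `I × S` is a compact set on which
`f` is continuous, and the path leaves it with probability less than `ε`. Finite unions of
such sets, with `ε = 1 / (n + 1)`, form the required increasing sequence.

The Borel structure of the Skorohod space enters only through measurability of the coordinate maps
(`SkorohodSpace.measurable_apply`), which makes the events `R ∩ U ≠ ∅` null measurable.
-/

open scoped ENNReal

/-! ### Choquet capacitability and hitting probabilities of random closed sets -/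

/-- An open neighbourhood of a compact box in Baire space contains a set that bounds only finitely
many coordinates. -/
theorem exists_forall_lt_le_subset_of_isOpen {V : Set (ℕ → ℕ)} (hV : IsOpen V) (k : ℕ → ℕ)
    (hk : {x : ℕ → ℕ | ∀ i, x i ≤ k i} ⊆ V) : ∃ m, {x : ℕ → ℕ | ∀ i < m, x i ≤ k i} ⊆ V := by
  by_contra! hne
  have hne' : ∀ m, ∃ x : ℕ → ℕ, (∀ i < m, x i ≤ k i) ∧ x ∉ V := fun m => not_subset.1 (hne m)
  choose x hx hxV using hne'
  have hcomp : IsCompact {x : ℕ → ℕ | ∀ i, x i ≤ k i} := by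
    have : {x : ℕ → ℕ | ∀ i, x i ≤ k i} = univ.pi fun i => Iic (k i) := by ext; simp [Pi.le_def]
    rw [this]
    exact isCompact_univ_pi fun i => (finite_Iic (k i)).isCompact
  -- Truncating the bad points at `k` puts them into the box without changing finitely many
  -- coordinates.
  obtain ⟨b, hb, hcl⟩ := hcomp.exists_mapClusterPt (f := atTop) (u := fun m i => min (x m i) (k i))
    (tendsto_principal.2 (Eventually.of_forall fun m i => min_le_right _ _))
  obtain ⟨J, u, hu, huV⟩ := isOpen_pi_iff.1 hV b (hk hb)
  have hmem : (J : Set ℕ).pi u ∈ 𝓝 b :=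
    set_pi_mem_nhds J.finite_toSet fun i hi => (hu i hi).1.mem_nhds (hu i hi).2
  obtain ⟨m, hm, hJ⟩ := ((hcl.frequently hmem).and_eventually
    (eventually_gt_atTop (J.sup id))).exists
  refine hxV m (huV fun i hi => ?_)
  have h1 : min (x m i) (k i) ∈ u i := hm i hi
  rwa [min_eq_left (hx m i ((Finset.le_sup (f := id) hi).trans_lt hJ))] at h1

/-- **Choquet's capacitability theorem**, for a monotone set function that is continuous along
increasing sequences and determined by its values on open sets. -/
theorem MeasureTheory.AnalyticSet.exists_isCompact_le {Y : Type*} [TopologicalSpace Y]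
    {c : Set Y → ℝ≥0∞} (hmono : Monotone c)
    (hsup : ∀ s : ℕ → Set Y, Monotone s → c (⋃ n, s n) ≤ ⨆ n, c (s n))
    (houter : ∀ s a, c s < a → ∃ U, IsOpen U ∧ s ⊆ U ∧ c U < a)
    {A : Set Y} (hA : AnalyticSet A) {a : ℝ≥0∞} (ha : a < c A) :
    ∃ C ⊆ A, IsCompact C ∧ a ≤ c C := by
  rw [AnalyticSet] at hA
  rcases hA with rfl | ⟨φ, hφ, rfl⟩
  · exact ⟨∅, Subset.rfl, isCompact_empty, ha.le⟩
  have hstep : ∀ (E : Set (ℕ → ℕ)) (m : ℕ), a < c (φ '' E) →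
      ∃ j, a < c (φ '' (E ∩ {x | x m ≤ j})) := by
    intro E m hE
    have hU : φ '' E = ⋃ j, φ '' (E ∩ {x | x m ≤ j}) := by
      rw [← image_iUnion, ← inter_iUnion, eq_univ_of_forall (s := ⋃ j, {x : ℕ → ℕ | x m ≤ j})
        fun x => mem_iUnion.2 ⟨x m, le_refl (x m)⟩, inter_univ]
    rw [hU] at hE
    exact lt_iSup_iff.1 (hE.trans_le (hsup _ fun i j hij =>
      image_mono (inter_subset_inter_right _ fun x (hx : x m ≤ i) => hx.trans hij)))
  choose! J hJ using hstep
  let E : ℕ → Set (ℕ → ℕ) := fun m => Nat.rec univ (fun m F => F ∩ {x | x m ≤ J F m}) m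
  have hE : ∀ m, a < c (φ '' E m) := by
    intro m
    induction m with
    | zero => simpa [E] using ha
    | succ m ih => exact hJ _ _ ih
  have hEsub : ∀ m, E m ⊆ {x | ∀ i < m, x i ≤ J (E i) i} := by
    intro m
    induction m with
    | zero => intro x _ i hi; omega
    | succ m ih =>
      intro x hx i hi
      rcases Nat.lt_succ_iff_lt_or_eq.1 hi with h | rfl
      · exact ih hx.1 i h
      · exact hx.2
  have hcomp : IsCompact {x : ℕ → ℕ | ∀ i, x i ≤ J (E i) i} := by
    have : {x : ℕ → ℕ | ∀ i, x i ≤ J (E i) i} = univ.pi fun i => Iic (J (E i) i) := by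
      ext; simp [Pi.le_def]
    rw [this]
    exact isCompact_univ_pi fun i => (finite_Iic _).isCompact
  refine ⟨φ '' {x | ∀ i, x i ≤ J (E i) i}, image_subset_range _ _, hcomp.image hφ, ?_⟩
  by_contra! hlt
  obtain ⟨U, hUo, hU, hcU⟩ := houter _ _ hlt
  obtain ⟨m, hm⟩ := exists_forall_lt_le_subset_of_isOpen (hUo.preimage hφ) (fun i => J (E i) i)
    (image_subset_iff.1 hU)
  exact absurd ((hE m).trans_le (hmono (image_subset_iff.2 ((hEsub m).trans hm)))) hcU.not_gt

section HittingCapacity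

variable {Ω Y : Type*} [MeasurableSpace Ω] (P : Measure Ω) (R : Ω → Set Y)

/-- Strong subadditivity of the outer measure of a measure, without measurability. -/
theorem measure_union_add_inter_le (s t : Set Ω) : P (s ∪ t) + P (s ∩ t) ≤ P s + P t := by
  rw [← measure_toMeasurable s, ← measure_toMeasurable t,
    ← measure_union_add_inter _ (measurableSet_toMeasurable P t)]
  gcongr <;> exact subset_toMeasurable _ _

/-- The (outer) probability that the random set `R` hits `A`. -/
noncomputable def hitProb (A : Set Y) : ℝ≥0∞ := P {ω | (R ω ∩ A).Nonempty}

theorem hitProb_union_add_inter_le (A B : Set Y) :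
    hitProb P R (A ∪ B) + hitProb P R (A ∩ B) ≤ hitProb P R A + hitProb P R B := by
  refine le_trans ?_ (measure_union_add_inter_le P _ _)
  refine add_le_add (measure_mono fun ω hω => ?_) (measure_mono fun ω hω => ?_)
  · simpa [inter_union_distrib_left, union_nonempty] using hω
  · exact ⟨hω.mono (inter_subset_inter_right _ inter_subset_left),
      hω.mono (inter_subset_inter_right _ inter_subset_right)⟩

theorem hitProb_iUnion {A : ℕ → Set Y} (hA : Monotone A) :
    hitProb P R (⋃ n, A n) = ⨆ n, hitProb P R (A n) := by
  have h : {ω | (R ω ∩ ⋃ n, A n).Nonempty} = ⋃ n, {ω | (R ω ∩ A n).Nonempty} := by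
    ext ω; simp [inter_iUnion]
  simp only [hitProb]
  rw [h]
  refine Monotone.measure_iUnion fun i j hij ω hω => ?_
  exact hω.mono (inter_subset_inter_right _ (hA hij))

variable [TopologicalSpace Y]

/-- The capacity of `A`: the infimum of the probabilities that `R` hits an open set containing
`A`. -/
noncomputable def hitCapacity (A : Set Y) : ℝ≥0∞ :=
  ⨅ U ∈ {U : Set Y | IsOpen U ∧ A ⊆ U}, hitProb P R U

variable {P R}

theorem exists_isOpen_hitProb_lt {A : Set Y} {a : ℝ≥0∞} (h : hitCapacity P R A < a) :
    ∃ U, IsOpen U ∧ A ⊆ U ∧ hitProb P R U < a := by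
  simp only [hitCapacity, iInf_lt_iff] at h
  obtain ⟨U, hU, h⟩ := h
  exact ⟨U, hU.1, hU.2, h⟩

theorem hitCapacity_le {A U : Set Y} (hU : IsOpen U) (h : A ⊆ U) :
    hitCapacity P R A ≤ hitProb P R U :=
  biInf_le (hitProb P R) (show U ∈ {U : Set Y | IsOpen U ∧ A ⊆ U} from ⟨hU, h⟩)

variable (P R) in
theorem hitCapacity_mono : Monotone (hitCapacity P R) := fun _ _ h =>
  le_iInf₂ fun _ hU => hitCapacity_le hU.1 (h.trans hU.2)

/-- The hitting capacity is continuous along increasing sequences: by strong subadditivity, the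
errors made in approximating the sets by open sets from outside add up. -/
theorem hitCapacity_iUnion_le [IsFiniteMeasure P] {A : ℕ → Set Y} (hA : Monotone A) :
    hitCapacity P R (⋃ n, A n) ≤ ⨆ n, hitCapacity P R (A n) := by
  have hfin : ∀ B, hitCapacity P R B ≠ ∞ := fun B =>
    ((hitCapacity_le isOpen_univ (subset_univ B)).trans_lt (measure_lt_top P _)).ne
  refine ENNReal.le_of_forall_pos_le_add fun ε hε _ => ?_
  obtain ⟨δ, hδ, hδε⟩ := ENNReal.exists_pos_sum_of_countable
    (ENNReal.coe_ne_zero.2 hε.ne') ℕ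
  have hex : ∀ n, ∃ U, IsOpen U ∧ A n ⊆ U ∧ hitProb P R U < hitCapacity P R (A n) + δ n :=
    fun n => exists_isOpen_hitProb_lt (ENNReal.lt_add_right (hfin _)
      (ENNReal.coe_ne_zero.2 (hδ n).ne'))
  choose U hUo hAU hU using hex
  have hV : ∀ n, hitProb P R (⋃ i ≤ n, U i) ≤
      hitCapacity P R (A n) + ∑ i ∈ Finset.range (n + 1), (δ i : ℝ≥0∞) := by
    intro n
    induction n with
    | zero => simpa using (hU 0).le
    | succ n ih =>
      have hsplit : ⋃ i ≤ n + 1, U i = (⋃ i ≤ n, U i) ∪ U (n + 1) := biUnion_le_succ U n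
      have hAn : hitCapacity P R (A n) ≤ hitProb P R ((⋃ i ≤ n, U i) ∩ U (n + 1)) :=
        hitCapacity_le ((isOpen_biUnion fun i _ => hUo i).inter (hUo _))
          (subset_inter ((hAU n).trans (subset_biUnion_of_mem (u := U) (le_refl n)))
            ((hA n.le_succ).trans (hAU _)))
      have hsub := hitProb_union_add_inter_le P R (⋃ i ≤ n, U i) (U (n + 1))
      rw [hsplit, Finset.sum_range_succ]
      refine (ENNReal.add_le_add_iff_right (hfin (A n))).1 ?_
      calc _ ≤ _ := add_le_add_right hAn _
        _ ≤ _ := hsub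
        _ ≤ _ := add_le_add ih (hU (n + 1)).le
        _ = _ := by ring
  have hmonoV : Monotone fun n => ⋃ i ≤ n, U i := fun m n hmn =>
    biUnion_mono (fun i (hi : i ≤ m) => hi.trans hmn) fun _ _ => Subset.rfl
  calc hitCapacity P R (⋃ n, A n) ≤ hitProb P R (⋃ n, ⋃ i ≤ n, U i) :=
        hitCapacity_le (isOpen_iUnion fun n => isOpen_biUnion fun i _ => hUo i)
          (iUnion_mono fun n => (hAU n).trans (subset_biUnion_of_mem (u := U) (le_refl n)))
    _ = ⨆ n, hitProb P R (⋃ i ≤ n, U i) := hitProb_iUnion P R hmonoV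
    _ ≤ _ := iSup_le fun n => (hV n).trans (add_le_add (le_iSup (fun n => hitCapacity P R (A n)) n)
        ((ENNReal.sum_le_tsum _).trans hδε.le))

end HittingCapacity

/-- If a random closed set almost surely avoids an analytic set `A`, then it avoids a whole open
neighbourhood of `A` with probability close to one. -/
theorem exists_isOpen_superset_hitProb_lt {Ω Y : Type*} [MeasurableSpace Ω] {P : Measure Ω}
    [IsFiniteMeasure P] [MetricSpace Y] {R : Ω → Set Y} (hR : ∀ ω, IsClosed (R ω))
    (hmeas : ∀ U, IsOpen U → NullMeasurableSet {ω | (R ω ∩ U).Nonempty} P)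
    {A : Set Y} (hA : AnalyticSet A) (hRA : ∀ᵐ ω ∂P, Disjoint (R ω) A) {ε : ℝ≥0∞} (hε : 0 < ε) :
    ∃ U, IsOpen U ∧ A ⊆ U ∧ hitProb P R U < ε := by
  refine exists_isOpen_hitProb_lt ((nonpos_iff_eq_zero.1 ?_).trans_lt hε)
  by_contra! hpos
  obtain ⟨a, ha0, ha⟩ := exists_between hpos
  obtain ⟨C, hCA, hC, haC⟩ := hA.exists_isCompact_le (hitCapacity_mono P R)
    (fun s hs => hitCapacity_iUnion_le hs)
    (fun s a h => by
      obtain ⟨U, hU, hsU, h'⟩ := exists_isOpen_hitProb_lt h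
      exact ⟨U, hU, hsU, (hitCapacity_le hU Subset.rfl).trans_lt h'⟩) ha
  -- The events that `R` hits the `1 / (m + 1)`-thickening of `C` decrease to the event that it
  -- hits `C`, which is null.
  let E : ℕ → Set Ω := fun m => {ω | (R ω ∩ Metric.thickening (1 / ((m : ℝ) + 1)) C).Nonempty}
  have hE : Tendsto (fun m => P (E m)) atTop (𝓝 (P (⋂ m, E m))) := by
    refine tendsto_measure_iInter_atTop (fun m => hmeas _ Metric.isOpen_thickening) ?_
      ⟨0, measure_ne_top _ _⟩
    exact fun m n hmn ω hω => hω.mono (inter_subset_inter_right _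
      (Metric.thickening_mono (Nat.one_div_le_one_div hmn) C))
  have hzero : P (⋂ m, E m) = 0 := by
    refine measure_mono_null (fun ω hω => ?_) (ae_iff.1 hRA)
    have hpt : ∀ m : ℕ, ∃ y ∈ C, ∃ r ∈ R ω, dist r y < 1 / ((m : ℝ) + 1) := fun m => by
      obtain ⟨r, hr, hrC⟩ := mem_iInter.1 hω m
      obtain ⟨y, hy, h⟩ := Metric.mem_thickening_iff.1 hrC
      exact ⟨y, hy, r, hr, h⟩
    choose y hyC r hrR hd using hpt
    obtain ⟨b, hb, φ, hφ, hlim⟩ := hC.tendsto_subseq hyC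
    have hrlim : Tendsto (r ∘ φ) atTop (𝓝 b) := by
      refine (tendsto_iff_of_dist ?_).2 hlim
      exact squeeze_zero (fun _ => dist_nonneg) (fun n => (hd (φ n)).le)
        (tendsto_one_div_add_atTop_nhds_zero_nat.comp hφ.tendsto_atTop)
    exact not_disjoint_iff.2 ⟨b, (hR ω).mem_of_tendsto hrlim (Eventually.of_forall fun n => hrR _),
      hCA hb⟩
  rw [hzero] at hE
  obtain ⟨m, hm⟩ := (hE.eventually_lt_const ha0).exists
  have := hitCapacity_le (P := P) (R := R) (Metric.isOpen_thickening (δ := 1 / ((m : ℝ) + 1)))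
    (Metric.self_subset_thickening (by positivity) C)
  exact absurd (haC.trans this) hm.not_ge

/-! ### Càdlàg paths and their left limits -/

section OneSidedLimits

/-- The closure of the trace of a right continuous path with left limits, over a compact set of
times, consists of values and left limits of the path. -/
theorem exists_eq_or_eq_of_mem_closure_image {T Y : Type*} [LinearOrder T]
    [TopologicalSpace T] [TopologicalSpace Y] [T2Space Y] {x xl : T → Y}
    (hr : ∀ t, Tendsto x (𝓝[>] t) (𝓝 (x t))) (hl : ∀ t, Tendsto x (𝓝[<] t) (𝓝 (xl t)))
    {J : Set T} (hJ : IsCompact J) {y : Y} (hy : y ∈ closure (x '' J)) :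
    ∃ t ∈ J, y = x t ∨ y = xl t := by
  have hne : (comap x (𝓝 y) ⊓ 𝓟 J).NeBot := by
    rw [← map_neBot_iff x, Filter.push_pull', map_principal]
    exact mem_closure_iff_clusterPt.1 hy
  let u := Ultrafilter.of (comap x (𝓝 y) ⊓ 𝓟 J)
  have hu : (u : Filter T) ≤ comap x (𝓝 y) ⊓ 𝓟 J := Ultrafilter.of_le _
  obtain ⟨t, ht, hut⟩ := hJ.ultrafilter_le_nhds u (hu.trans inf_le_right)
  have hxy : Tendsto x u (𝓝 y) := tendsto_iff_comap.2 (hu.trans inf_le_left)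
  refine ⟨t, ht, ?_⟩
  have hsides : ∀ s : T, s ∈ Iio t ∪ ({t} ∪ Ioi t) := fun s => by
    simp
  rcases Ultrafilter.union_mem_iff.1 (univ_mem' hsides : Iio t ∪ ({t} ∪ Ioi t) ∈ u) with h | h
  · exact Or.inr (tendsto_nhds_unique hxy ((hl t).mono_left (le_inf hut (le_principal_iff.2 h))))
  rcases Ultrafilter.union_mem_iff.1 h with h | h
  · have h' : Tendsto x u (𝓝 (x t)) := tendsto_nhds_of_eventually_eq <| by
      filter_upwards [h] with s hs using congrArg x hs
    exact Or.inl (tendsto_nhds_unique hxy h')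
  · exact Or.inl (tendsto_nhds_unique hxy ((hr t).mono_left (le_inf hut (le_principal_iff.2 h))))

variable {T Y : Type*} [LinearOrder T] [TopologicalSpace T] [OrderTopology T] [TopologicalSpace Y]

/-- The left limits of a function converge from the right to the right limit of the function. -/
theorem tendsto_leftLim_nhdsGT [T3Space Y] {x : T → Y} {t : T} {l : Y}
    (hl : ∀ s, ∃ l, Tendsto x (𝓝[<] s) (𝓝 l)) (hr : Tendsto x (𝓝[>] t) (𝓝 l)) :
    Tendsto (Function.leftLim x) (𝓝[>] t) (𝓝 l) := by
  rcases eq_or_neBot (𝓝[>] t) with h | hne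
  · simp [h]
  obtain ⟨b, hb⟩ : ∃ b, t < b := hne.nonempty_of_mem self_mem_nhdsWithin
  refine (closed_nhds_basis l).tendsto_right_iff.2 fun V ⟨hV, hVc⟩ => ?_
  obtain ⟨c, hc, hsub⟩ := (nhdsGT_basis_of_exists_gt ⟨b, hb⟩).eventually_iff.1
    (hr.eventually_mem hV)
  filter_upwards [Ioo_mem_nhdsGT hc] with s hs
  rcases eq_or_neBot (𝓝[<] s) with h | hne'
  · rw [leftLim_eq_of_eq_bot x h]
    exact hsub hs
  · refine hVc.mem_of_tendsto (tendsto_leftLim_of_tendsto (hl s)) ?_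
    filter_upwards [Ioo_mem_nhdsLT hs.1] with r hr
    exact hsub ⟨hr.1, hr.2.trans hs.2⟩

theorem tendsto_leftLim_nhdsLT [T3Space Y] {x : T → Y} {t : T}
    (hl : ∃ l, Tendsto x (𝓝[<] t) (𝓝 l)) :
    Tendsto (Function.leftLim x) (𝓝[<] t) (𝓝 (Function.leftLim x t)) :=
  (continuousWithinAt_leftLim_Iic (tendsto_leftLim_of_tendsto hl)).tendsto.mono_left
    (nhdsWithin_mono _ Iio_subset_Iic_self)

/-- A right continuous function has points of continuity in every nonempty open interval: the
points with oscillation less than `ε` form a dense open set, so Baire's theorem applies. -/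
theorem exists_mem_Ioo_continuousAt {M : Type*} [PseudoMetricSpace M] [DenselyOrdered T]
    [BaireSpace T] {x : T → M} (hr : ∀ t, Tendsto x (𝓝[>] t) (𝓝 (x t))) {a b : T} (hab : a < b) :
    ∃ s ∈ Ioo a b, ContinuousAt x s := by
  have : Nontrivial T := ⟨a, b, hab.ne⟩
  let O : ℕ → Set T := fun m =>
    ⋃₀ {V | IsOpen V ∧ ∀ u ∈ V, ∀ v ∈ V, dist (x u) (x v) < 1 / ((m : ℝ) + 1)}
  have hO : ∀ m, IsOpen (O m) := fun m => isOpen_sUnion fun V hV => hV.1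
  have hd : ∀ m, Dense (O m) := by
    intro m
    refine dense_iff_inter_open.2 fun W hW hWne => ?_
    obtain ⟨c, d, hcd, hsub⟩ := hW.exists_Ioo_subset hWne
    obtain ⟨s, hs⟩ := exists_between hcd
    have hball : ∀ᶠ u in 𝓝[>] s, dist (x u) (x s) < 1 / ((m : ℝ) + 1) / 2 :=
      (hr s).eventually_mem (Metric.ball_mem_nhds _ (by positivity))
    obtain ⟨e, he, hev⟩ := (nhdsGT_basis_of_exists_gt ⟨d, hs.2⟩).eventually_iff.1 hball
    obtain ⟨r, hr1, hr2⟩ := exists_between (lt_min he hs.2)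
    refine ⟨r, hsub ⟨hs.1.trans hr1, hr2.trans_le (min_le_right _ _)⟩, Ioo s e,
      ⟨isOpen_Ioo, fun u hu v hv => ?_⟩, hr1, hr2.trans_le (min_le_left _ _)⟩
    calc dist (x u) (x v) ≤ dist (x u) (x s) + dist (x v) (x s) := dist_triangle_right _ _ _
      _ < _ := by linarith [hev hu, hev hv]
  obtain ⟨s, hs, hsO⟩ := (dense_iInter_of_isOpen hO hd).inter_open_nonempty _ isOpen_Ioo
    (nonempty_Ioo.2 hab)
  refine ⟨s, hs, Metric.continuousAt_iff'.2 fun ε hε => ?_⟩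
  obtain ⟨m, hm⟩ := exists_nat_one_div_lt hε
  obtain ⟨V, ⟨hVo, hV⟩, hsV⟩ := mem_iInter.1 hsO m
  filter_upwards [hVo.mem_nhds hsV] with r hrV
  exact (hV r hrV s hsV).trans hm

/-- If `f (t, x t)` has left limits and `f (t, x (t-))` is left continuous, then the left limit of
`f (t, x t)` is `f (t, x (t-))`: the two functions agree at the continuity points of `x`, which are
dense. -/
theorem tendsto_comp_nhdsLT_leftLim {M Z : Type*} [MetricSpace M] [TopologicalSpace Z] [T2Space Z]
    [DenselyOrdered T] [BaireSpace T] {x : T → M} (hr : ∀ t, Tendsto x (𝓝[>] t) (𝓝 (x t)))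
    {f : T × M → Z} {t : T} (hl : ∃ l, Tendsto (fun s => f (s, x s)) (𝓝[<] t) (𝓝 l))
    (hlc : Tendsto (fun s => f (s, Function.leftLim x s)) (𝓝[<] t)
      (𝓝 (f (t, Function.leftLim x t)))) :
    Tendsto (fun s => f (s, x s)) (𝓝[<] t) (𝓝 (f (t, Function.leftLim x t))) := by
  rcases eq_or_neBot (𝓝[<] t) with h | hne
  · simp [h]
  obtain ⟨a, ha⟩ : ∃ a, a < t := hne.nonempty_of_mem self_mem_nhdsWithin
  obtain ⟨l, hl⟩ := hl
  have hfreq : ∃ᶠ s in 𝓝[<] t, f (s, x s) = f (s, Function.leftLim x s) := by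
    refine (nhdsLT_basis_of_exists_lt ⟨a, ha⟩).frequently_iff.2 fun b hb => ?_
    obtain ⟨s, hs, hc⟩ := exists_mem_Ioo_continuousAt hr hb
    exact ⟨s, hs, by rw [hc.continuousWithinAt.leftLim_eq]⟩
  rwa [← tendsto_nhds_unique_of_frequently_eq hl hlc hfreq]

end OneSidedLimits

/-- Countably many times up to `n` suffice to approach every time `t ≤ n` from the right. The time
`n` and a last point of `I` have to be among them. -/
theorem exists_countable_frequently_nhdsGT (I : Set ℝ) [I.OrdConnected] (n : ℝ) :
    ∃ Q : Set I, Q.Countable ∧ (∀ t ∈ Q, (t : ℝ) ≤ n) ∧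
      ∀ t : I, (t : ℝ) ≤ n → t ∈ Q ∨ ∃ᶠ s in 𝓝[>] t, s ∈ Q := by
  obtain ⟨D, hDc, hD⟩ := TopologicalSpace.exists_countable_dense I
  refine ⟨{t | (t : ℝ) ≤ n ∧ (t ∈ D ∨ (t : ℝ) = n ∨ IsTop t)}, ?_, fun t ht => ht.1,
    fun t ht => ?_⟩
  · refine (hDc.union ((?_ : {t : I | (t : ℝ) = n}.Countable).union
      (?_ : {t : I | IsTop t}.Countable))).mono fun t ht => ht.2
    · exact Subsingleton.countable fun a ha b hb => Subtype.ext (Eq.trans ha (Eq.symm hb))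
    · exact Subsingleton.countable fun a ha b hb => le_antisymm (hb a) (ha b)
  · by_cases htop : (t : ℝ) = n ∨ IsTop t
    · exact Or.inl ⟨ht, Or.inr htop⟩
    push Not at htop
    obtain ⟨b, hb⟩ : ∃ b, t < b := by simpa [IsTop] using htop.2
    refine Or.inr ((nhdsGT_basis_of_exists_gt ⟨b, hb⟩).frequently_iff.2 fun c hc => ?_)
    have htn : (t : ℝ) < n := lt_of_le_of_ne ht htop.1
    -- the open set of times in `(t, c)` below `n`
    obtain ⟨s, hsD, hs1, hs2⟩ := hD.exists_mem_open
      (isOpen_Ioo.inter (isOpen_Iio.preimage continuous_subtype_val) :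
        IsOpen (Ioo t c ∩ Subtype.val ⁻¹' Iio n)) <| by
      have hmin : min (c : ℝ) n ∈ Ioc (t : ℝ) c := ⟨lt_min hc htn, min_le_left _ _⟩
      have hI : (t + min (c : ℝ) n) / 2 ∈ I :=
        (‹I.OrdConnected›.out t.2 c.2) ⟨by linarith [hmin.1], by linarith [hmin.1, hmin.2]⟩
      refine ⟨⟨_, hI⟩, ⟨?_, ?_⟩, ?_⟩
      · exact Subtype.mk_lt_mk.2 (by linarith [hmin.1] : (t : ℝ) < _)
      · exact Subtype.mk_lt_mk.2 (by linarith [hmin.1, hmin.2] : _ < (c : ℝ))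
      · change (t + min (c : ℝ) n) / 2 < n
        linarith [min_le_right (c : ℝ) n]
    exact ⟨s, hs1, le_of_lt hs2, Or.inl hsD⟩

/-! ### Measurability of the coordinates on the Skorohod space -/

namespace SkorohodSpace

variable {I : Set ℝ} {S : Type*}

section Pseudo

variable [PseudoMetricSpace S]

theorem isOpen_iff {U : Set (SkorohodSpace I S)} :
    IsOpen U ↔ ∀ ω ∈ U, ∃ N : ℕ, ∃ ε : ℝ, 0 < ε ∧ basicNhd ω N ε ⊆ U :=
  Iff.rfl

/-- Visiting an open set during an open time interval is an open event. -/
theorem isOpen_setOf_exists_mem_Ioo [I.OrdConnected] (a b : ℝ) {U : Set S} (hU : IsOpen U) :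
    IsOpen {ω : SkorohodSpace I S | ∃ s : I, (s : ℝ) ∈ Ioo a b ∧ ω s ∈ U} := by
  refine isOpen_iff.2 fun ω ⟨s, hs, hωs⟩ => ?_
  obtain ⟨δ, hδ, hball⟩ := Metric.isOpen_iff.1 hU _ hωs
  obtain ⟨η, hη, hIoo⟩ := Metric.isOpen_iff.1 isOpen_Ioo _ hs
  let ε := min δ η
  obtain ⟨N, hN⟩ := exists_nat_ge ((s : ℝ) + ε)
  refine ⟨N, ε, lt_min hδ hη, fun ω' ⟨l, hl⟩ => ?_⟩
  have hε : 0 < ε := lt_min hδ hη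
  have htN : (l.symm s : ℝ) ≤ N := by
    by_contra! hlt
    have hNI : (N : ℝ) ∈ I := ‹I.OrdConnected›.out s.2 (l.symm s).2 ⟨by linarith, hlt.le⟩
    have h1 := (hl ⟨N, hNI⟩ le_rfl).1
    have h2 : l ⟨N, hNI⟩ < l (l.symm s) := l.lt_iff_lt.2 (Subtype.mk_lt_mk.2 hlt)
    rw [l.apply_symm_apply] at h2
    have h2' : (l ⟨N, hNI⟩ : ℝ) < s := h2
    rw [Subtype.dist_eq, Real.dist_eq, abs_lt] at h1
    change _ < (l ⟨N, hNI⟩ : ℝ) - N ∧ _ at h1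
    linarith [h1.1]
  obtain ⟨h1, h2⟩ := hl _ htN
  rw [l.apply_symm_apply] at h1 h2
  refine ⟨l.symm s, hIoo ?_, hball (h2.trans_le (min_le_left _ _))⟩
  rw [Metric.mem_ball, dist_comm]
  exact h1.trans_le (min_le_right _ _)

/-- The terminal value of a path depends continuously on the path. -/
theorem isOpen_setOf_apply_mem_of_isTop {t : I} (ht : IsTop t) {U : Set S} (hU : IsOpen U) :
    IsOpen {ω : SkorohodSpace I S | ω t ∈ U} := by
  refine isOpen_iff.2 fun ω hω => ?_
  obtain ⟨δ, hδ, hball⟩ := Metric.isOpen_iff.1 hU _ hω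
  obtain ⟨N, hN⟩ := exists_nat_ge (t : ℝ)
  refine ⟨N, δ, hδ, fun ω' ⟨l, hl⟩ => hball ?_⟩
  have hlt : l t = t := le_antisymm (ht _) (l.symm_apply_le.1 (ht _))
  have := (hl t hN).2
  rwa [hlt] at this

/-- The coordinate maps of the Skorohod space are Borel measurable: by right continuity, `ω t` lies
in a closed set `F` iff `ω` visits each neighbourhood of `F` immediately after `t`. -/
theorem measurable_apply [I.OrdConnected] [MeasurableSpace S] [BorelSpace S] (t : I) :
    Measurable fun ω : SkorohodSpace I S => ω t := by
  by_cases ht : IsTop t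
  · exact measurable_of_isOpen fun U hU => (isOpen_setOf_apply_mem_of_isTop ht hU).measurableSet
  obtain ⟨b, hb⟩ : ∃ b, t < b := by simpa [IsTop] using ht
  have : (𝓝[>] t).NeBot := nhdsGT_neBot_of_exists_gt ⟨b, hb⟩
  refine measurable_of_isClosed fun F hF => ?_
  have hset : (fun ω : SkorohodSpace I S => ω t) ⁻¹' F =
      ⋂ m : ℕ, {ω : SkorohodSpace I S | ∃ s : I, (s : ℝ) ∈ Ioo (t : ℝ) (t + 1 / ((m : ℝ) + 1)) ∧
        ω s ∈ Metric.thickening (1 / ((m : ℝ) + 1)) F} := by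
    ext ω
    simp only [mem_preimage, mem_iInter, mem_ofPred_eq]
    constructor
    · intro h m
      have hpos : (0 : ℝ) < 1 / ((m : ℝ) + 1) := by positivity
      have h1 : ∀ᶠ s in 𝓝[>] t, ω s ∈ Metric.thickening (1 / ((m : ℝ) + 1)) F :=
        (ω.isCadlag t).1.eventually_mem
          (Metric.isOpen_thickening.mem_nhds (Metric.self_subset_thickening hpos F h))
      have h2 : ∀ᶠ s : I in 𝓝[>] t, (s : ℝ) < t + 1 / ((m : ℝ) + 1) :=
        nhdsWithin_le_nhds (continuous_subtype_val.continuousAt.eventually_lt_const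
          (by linarith))
      obtain ⟨s, hs1, hs2, hs3⟩ := (h1.and (h2.and self_mem_nhdsWithin)).exists
      exact ⟨s, ⟨hs3, hs2⟩, hs1⟩
    · intro h
      choose s hs hsF using h
      choose y hyF hy using fun m => Metric.mem_thickening_iff.1 (hsF m)
      have hst : Tendsto s atTop (𝓝[>] t) := by
        refine tendsto_nhdsWithin_iff.2 ⟨tendsto_subtype_rng.2 ?_,
          Eventually.of_forall fun m => (hs m).1⟩
        refine tendsto_of_tendsto_of_tendsto_of_le_of_le tendsto_const_nhds ?_
          (fun m => (hs m).1.le) (fun m => (hs m).2.le)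
        simpa using tendsto_const_nhds.add (tendsto_one_div_add_atTop_nhds_zero_nat (𝕜 := ℝ))
      have hω : Tendsto (fun m => ω (s m)) atTop (𝓝 (ω t)) := (ω.isCadlag t).1.comp hst
      refine hF.mem_of_tendsto ((tendsto_iff_of_dist ?_).1 hω) (Eventually.of_forall hyF)
      exact squeeze_zero (fun _ => dist_nonneg) (fun m => (hy m).le)
        tendsto_one_div_add_atTop_nhds_zero_nat
  rw [hset]
  exact MeasurableSet.iInter fun m =>
    (isOpen_setOf_exists_mem_Ioo _ _ Metric.isOpen_thickening).measurableSet

end Pseudo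

theorem tendsto_leftLim [TopologicalSpace S] [I.OrdConnected] (ω : SkorohodSpace I S) (t : I) :
    Tendsto ω (𝓝[<] t) (𝓝 (Function.leftLim ω t)) :=
  tendsto_leftLim_of_tendsto (ω.isCadlag t).2

end SkorohodSpace

/-! ### Quasi continuity and regularity of paths -/

section

variable {S : Type*} [MetricSpace S] {I : Set ℝ}

/-- If the path `(t, ω t)` stays in compact sets on which `f` is continuous, then `f (t, ω t)` is
càdlàg and `f (t, ω (t-))` is càglàd, since the left limits stay in these sets as well. -/
theorem isCadlag_and_isCaglad_of_continuousOn [I.OrdConnected] (ω : SkorohodSpace I S)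
    {f : I × S → ℝ} {K : ℕ → Set (I × S)} (hK : ∀ n, IsClosed (K n))
    (hf : ∀ n, ContinuousOn f (K n))
    (hω : ∀ N : ℕ, ∃ n ≥ N, ∀ s : I, (s : ℝ) ≤ n → (s, ω s) ∈ K n) :
    IsCadlag (fun t : I => f (t, ω t)) ∧
      IsCaglad (fun t : I => f (t, Function.leftLim (ω : I → S) t)) := by
  have hlocal : ∀ t : I, ∃ n : ℕ, (∀ᶠ s in 𝓝 t, (s, ω s) ∈ K n) ∧
      ∀ᶠ s in 𝓝 t, (s, Function.leftLim ω s) ∈ K n := by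
    intro t
    obtain ⟨N, hN⟩ := exists_nat_gt (t : ℝ)
    obtain ⟨n, hn, hmem⟩ := hω N
    have hlt : ∀ᶠ s : I in 𝓝 t, (s : ℝ) < n :=
      continuous_subtype_val.continuousAt.eventually_lt_const
        (hN.trans_le (by exact_mod_cast hn))
    refine ⟨n, hlt.mono fun s hs => hmem s hs.le, hlt.mono fun s hs => ?_⟩
    rcases eq_or_neBot (𝓝[<] s) with h | hne
    · rw [leftLim_eq_of_eq_bot _ h]
      exact hmem s hs.le
    · refine (hK n).mem_of_tendsto ((tendsto_id'.2 nhdsWithin_le_nhds).prodMk_nhds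
        (ω.tendsto_leftLim s)) ?_
      filter_upwards [self_mem_nhdsWithin] with r hr
      exact hmem r ((show (r : ℝ) < s from hr).le.trans hs.le)
  have key : ∀ (t : I) (x : I → S) (l : Filter I) (y : S), l ≤ 𝓝 t → Tendsto x l (𝓝 y) →
      (∃ n, (∀ᶠ s in l, (s, x s) ∈ K n) ∧ (t, y) ∈ K n) →
      Tendsto (fun s => f (s, x s)) l (𝓝 (f (t, y))) := by
    rintro t x l y hl hx ⟨n, hev, hmem⟩
    exact (hf n _ hmem).tendsto.comp (tendsto_nhdsWithin_iff.2
      ⟨(tendsto_id'.2 hl).prodMk_nhds hx, hev⟩)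
  refine ⟨fun t => ?_, fun t => ?_⟩ <;> obtain ⟨n, h1, h2⟩ := hlocal t
  · exact ⟨key t ω _ _ nhdsWithin_le_nhds (ω.isCadlag t).1
      ⟨n, h1.filter_mono nhdsWithin_le_nhds, h1.self_of_nhds⟩,
      _, key t ω _ _ nhdsWithin_le_nhds (ω.tendsto_leftLim t)
      ⟨n, h1.filter_mono nhdsWithin_le_nhds, h2.self_of_nhds⟩⟩
  · exact ⟨key t _ _ _ nhdsWithin_le_nhds (tendsto_leftLim_nhdsLT (ω.isCadlag t).2)
      ⟨n, h2.filter_mono nhdsWithin_le_nhds, h2.self_of_nhds⟩,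
      _, key t _ _ _ nhdsWithin_le_nhds
        (tendsto_leftLim_nhdsGT (fun s => (ω.isCadlag s).2) (ω.isCadlag t).1)
      ⟨n, h2.filter_mono nhdsWithin_le_nhds, h1.self_of_nhds⟩⟩

/-- A quasi continuous function is almost surely càdlàg along the paths, and càglàd along their left
limits. -/
theorem QuasiContinuous.ae_isCadlag_and_isCaglad [I.OrdConnected] {P : Measure (SkorohodSpace I S)}
    {f : I × S → ℝ} (hf : QuasiContinuous P f) :
    ∀ᵐ ω : SkorohodSpace I S ∂P, IsCadlag (fun t : I => f (t, ω t)) ∧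
      IsCaglad (fun t : I => f (t, Function.leftLim (ω : I → S) t)) := by
  obtain ⟨K, -, hK, hlim, hcont⟩ := hf
  have hae : ∀ᵐ ω : SkorohodSpace I S ∂P, ∀ N : ℕ, ∃ n ≥ N, ∀ s : I, (s : ℝ) ≤ n → (s, ω s) ∈ K n := by
    refine ae_all_iff.2 fun N => ?_
    refine ae_iff.2 (nonpos_iff_eq_zero.1 (ge_of_tendsto hlim ?_))
    filter_upwards [eventually_ge_atTop N] with n hn
    refine measure_mono fun ω hω => ?_
    simp only [mem_ofPred_eq] at hω ⊢
    push Not at hω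
    exact hω n hn
  filter_upwards [hae] with ω hω
  exact isCadlag_and_isCaglad_of_continuousOn ω (fun n => (hK n).isClosed) hcont hω

end

section

variable {S : Type*} [MetricSpace S] [MeasurableSpace S] [BorelSpace S] {I : Set ℝ}

/-- The event that a process with right continuous paths enters an open set is null measurable. -/
theorem nullMeasurableSet_setOf_exists_mem {Ω Y : Type*} [MeasurableSpace Ω] {P : Measure Ω}
    [TopologicalSpace Y] [MeasurableSpace Y] [OpensMeasurableSpace Y] [I.OrdConnected]
    {X : Ω → I → Y} (hX : ∀ t, Measurable fun ω => X ω t)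
    (hr : ∀ᵐ ω ∂P, ∀ t, Tendsto (X ω) (𝓝[>] t) (𝓝 (X ω t))) (n : ℝ) {U : Set Y} (hU : IsOpen U) :
    NullMeasurableSet {ω | ∃ t : I, (t : ℝ) ≤ n ∧ X ω t ∈ U} P := by
  obtain ⟨Q, hQc, hQn, hQ⟩ := exists_countable_frequently_nhdsGT I n
  have hmeas : MeasurableSet (⋃ t ∈ Q, {ω | X ω t ∈ U}) :=
    MeasurableSet.biUnion hQc fun t _ => hX t hU.measurableSet
  refine hmeas.nullMeasurableSet.congr ?_
  filter_upwards [hr] with ω hω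
  refine propext ⟨fun h => ?_, ?_⟩
  · obtain ⟨t, ht, h⟩ := mem_iUnion₂.1 h
    exact ⟨t, hQn t ht, h⟩
  · rintro ⟨t, ht, h⟩
    rcases hQ t ht with htQ | hfr
    · exact mem_iUnion₂.2 ⟨t, htQ, h⟩
    · obtain ⟨s, hs, hsU⟩ := (hfr.and_eventually ((hω t).eventually_mem (hU.mem_nhds h))).exists
      exact mem_iUnion₂.2 ⟨s, hs, hsU⟩

/-- The complement of the graph of a Borel function on a co-Souslin space is analytic, in a Polish
space containing the graph. -/
theorem analyticSet_compl_range_graph {T S K : Type*} [TopologicalSpace T] [PolishSpace T]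
    [MeasurableSpace T] [BorelSpace T] [TopologicalSpace S] [MeasurableSpace S] [BorelSpace S]
    [TopologicalSpace K] [PolishSpace K] {e : S → K} (he : IsEmbedding e)
    (hA : AnalyticSet (range e)ᶜ) {h : T × S → ℝ} (hh : Measurable h) :
    AnalyticSet (range fun p : T × S => (p.1, e p.2, h p))ᶜ := by
  borelize K
  have : SecondCountableTopology S := he.secondCountableTopology
  have hφ : IsEmbedding (Prod.map id e : T × S → T × K) := IsEmbedding.id.prodMap he
  have hσ : (inferInstance : MeasurableSpace (T × K)).comap (Prod.map id e) =
      (inferInstance : MeasurableSpace (T × S)) := by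
    rw [BorelSpace.measurable_eq (α := T × K), BorelSpace.measurable_eq (α := T × S),
      hφ.eq_induced, borel_comap]
  obtain ⟨g, hg, hgh⟩ := Measurable.exists_eq_measurable_comp (f := Prod.map id e)
    (show Measurable[(inferInstance : MeasurableSpace (T × K)).comap (Prod.map id e)] h by
      rw [hσ]; exact hh)
  have hset : (range fun p : T × S => (p.1, e p.2, h p))ᶜ =
      ⋃ b : Bool, bif b then (fun q : T × K × ℝ => q.2.1) ⁻¹' (range e)ᶜ
        else {q : T × K × ℝ | g (q.1, q.2.1) = q.2.2}ᶜ := by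
    rw [← compl_inj_iff, compl_compl]
    ext ⟨t, k, r⟩
    simp only [hgh, mem_range, Prod.mk.injEq, Prod.exists, compl_iUnion, mem_iInter, Bool.forall_bool,
      cond_true, cond_false, mem_compl_iff, not_not, mem_preimage, mem_ofPred_eq, Function.comp,
      Prod.map, id]
    constructor
    · rintro ⟨_, x, rfl, rfl, rfl⟩
      exact ⟨rfl, x, rfl⟩
    · rintro ⟨hg, x, rfl⟩
      exact ⟨t, x, rfl, rfl, hg⟩
  rw [hset]
  refine AnalyticSet.iUnion fun b => ?_
  cases b
  · refine MeasurableSet.analyticSet (MeasurableSet.compl ?_)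
    exact measurableSet_eq_fun (hg.comp (by fun_prop)) (by fun_prop)
  · exact hA.preimage (by fun_prop)

/-- A compact part of the graph of `h` projects onto a compact set on which `h` is continuous. -/
theorem isCompact_and_continuousOn_of_graph {T S K : Type*} [TopologicalSpace T] [T2Space T]
    [TopologicalSpace S] [T2Space S] [TopologicalSpace K] {e : S → K} (he : IsEmbedding e)
    {h : T × S → ℝ} {W : Set (T × K × ℝ)} (hW : IsCompact W)
    (hgraph : W ⊆ range fun p : T × S => (p.1, e p.2, h p)) :
    IsCompact {p : T × S | (p.1, e p.2, h p) ∈ W} ∧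
      ContinuousOn h {p : T × S | (p.1, e p.2, h p) ∈ W} := by
  have hφ : IsEmbedding (Prod.map id e : T × S → T × K) := IsEmbedding.id.prodMap he
  have key : ∀ F : Set ℝ, IsClosed F →
      IsCompact {p : T × S | (p.1, e p.2, h p) ∈ W ∧ h p ∈ F} := by
    intro F hF
    rw [hφ.isCompact_iff]
    have himg : Prod.map id e '' {p : T × S | (p.1, e p.2, h p) ∈ W ∧ h p ∈ F} =
        (fun q : T × K × ℝ => (q.1, q.2.1)) '' (W ∩ (fun q => q.2.2) ⁻¹' F) := by
      ext q
      constructor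
      · rintro ⟨p, ⟨hp, hF⟩, rfl⟩
        exact ⟨_, ⟨hp, hF⟩, rfl⟩
      · rintro ⟨w, ⟨hw, hwF⟩, rfl⟩
        obtain ⟨p, rfl⟩ := hgraph hw
        exact ⟨p, ⟨hw, hwF⟩, rfl⟩
    rw [himg]
    exact (hW.inter_right (hF.preimage (by fun_prop))).image (by fun_prop)
  refine ⟨by simpa using key univ isClosed_univ, continuousOn_iff_isClosed.2 fun F hF =>
    ⟨_, (key F hF).isClosed, ?_⟩⟩
  ext p
  simp only [mem_inter_iff, mem_preimage, mem_ofPred_eq]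
  tauto

/-- For bounded `h`, the path `(t, ω t)` stays up to time `n` in a compact set on which `h` is
continuous, with probability close to one. -/
theorem exists_isCompact_continuousOn_measure_lt (hS : IsCoSouslin S) [I.OrdConnected]
    (hIc : IsClosed I) (hI0 : I ⊆ Ici 0) {h : I × S → ℝ} (hh : Measurable h) {C : ℝ}
    (hC : ∀ p, |h p| ≤ C) {P : Measure (SkorohodSpace I S)} [IsFiniteMeasure P]
    (hcad : ∀ᵐ ω ∂P, IsCadlag fun t : I => h (t, ω t))
    (hcag : ∀ᵐ ω : SkorohodSpace I S ∂P,
      IsCaglad fun t : I => h (t, Function.leftLim (ω : I → S) t))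
    (n : ℝ) {ε : ℝ≥0∞} (hε : 0 < ε) :
    ∃ K : Set (I × S), IsCompact K ∧ ContinuousOn h K ∧
      P {ω | ∃ s : I, (s : ℝ) ≤ n ∧ (s, ω s) ∉ K} < ε := by
  obtain ⟨K, _, _, _, e, he, hA⟩ := hS
  borelize K
  let _ : MetricSpace K := TopologicalSpace.metrizableSpaceMetric K
  have : SecondCountableTopology S := he.secondCountableTopology
  have : PolishSpace I := hIc.polishSpace
  let X : SkorohodSpace I S → I → I × K × ℝ := fun ω t => (t, e (ω t), h (t, ω t))
  let J : Set I := {t | (t : ℝ) ≤ n}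
  have hJ : IsCompact J := by
    have hemb : IsClosedEmbedding (Subtype.val : I → ℝ) := hIc.isClosedEmbedding_subtypeVal
    convert hemb.isCompact_preimage (isCompact_Icc (a := 0) (b := n)) using 1
    ext t
    simpa [J] using fun _ => hI0 t.2
  have hXmeas : ∀ t, Measurable fun ω => X ω t := fun t =>
    measurable_const.prodMk ((he.continuous.measurable.comp (SkorohodSpace.measurable_apply t)).prodMk
      (hh.comp (measurable_const.prodMk (SkorohodSpace.measurable_apply t))))
  have hXr : ∀ᵐ ω ∂P, ∀ t, Tendsto (X ω) (𝓝[>] t) (𝓝 (X ω t)) := by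
    filter_upwards [hcad] with ω hω t
    exact (tendsto_id'.2 nhdsWithin_le_nhds).prodMk_nhds
      (((he.continuous.tendsto _).comp (ω.isCadlag t).1).prodMk_nhds (hω t).1)
  have havoid : ∀ᵐ ω ∂P, Disjoint (closure (X ω '' J))
      (range fun p : I × S => (p.1, e p.2, h p))ᶜ := by
    filter_upwards [hcad, hcag, hXr] with ω h1 h2 h3
    refine disjoint_compl_right_iff_subset.2 fun y hy => ?_
    have hl : ∀ t, Tendsto (X ω) (𝓝[<] t)
        (𝓝 (t, e (Function.leftLim ω t), h (t, Function.leftLim ω t))) := fun t =>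
      (tendsto_id'.2 nhdsWithin_le_nhds).prodMk_nhds
        (((he.continuous.tendsto _).comp (ω.tendsto_leftLim t)).prodMk_nhds
          (tendsto_comp_nhdsLT_leftLim (fun s => (ω.isCadlag s).1) (h1 t).2 (h2 t).1))
    obtain ⟨t, -, rfl | rfl⟩ := exists_eq_or_eq_of_mem_closure_image h3 hl hJ hy
    · exact ⟨(t, ω t), rfl⟩
    · exact ⟨(t, Function.leftLim ω t), rfl⟩
  have hhit : ∀ U : Set (I × K × ℝ), IsOpen U →
      {ω | (closure (X ω '' J) ∩ U).Nonempty} = {ω | ∃ t : I, (t : ℝ) ≤ n ∧ X ω t ∈ U} := by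
    intro U hU
    ext ω
    simp only [mem_ofPred_eq, closure_inter_open_nonempty_iff hU]
    constructor
    · rintro ⟨_, ⟨t, ht, rfl⟩, hU⟩
      exact ⟨t, ht, hU⟩
    · rintro ⟨t, ht, hU⟩
      exact ⟨_, ⟨t, ht, rfl⟩, hU⟩
  obtain ⟨U, hU, hAU, hPU⟩ := exists_isOpen_superset_hitProb_lt (P := P)
    (R := fun ω => closure (X ω '' J)) (fun ω => isClosed_closure)
    (fun U hU => by
      rw [hhit U hU]
      exact nullMeasurableSet_setOf_exists_mem hXmeas hXr n hU)
    (analyticSet_compl_range_graph he hA hh) havoid hε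
  have hPU' : P {ω | ∃ t : I, (t : ℝ) ≤ n ∧ X ω t ∈ U} < ε := by
    rwa [hitProb, hhit U hU] at hPU
  have hWc : IsCompact ((J ×ˢ univ ×ˢ Icc (-C) C) ∩ Uᶜ) :=
    (hJ.prod (isCompact_univ.prod isCompact_Icc)).inter_right hU.isClosed_compl
  obtain ⟨h1, h2⟩ := isCompact_and_continuousOn_of_graph he hWc (h := h)
    (inter_subset_right.trans (compl_subset_comm.1 hAU))
  refine ⟨_, h1, h2, lt_of_le_of_lt (measure_mono ?_) hPU'⟩
  rintro ω ⟨s, hs, hns⟩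
  refine ⟨s, hs, ?_⟩
  by_contra hnU
  exact hns ⟨⟨hs, mem_univ _, abs_le.1 (hC _)⟩, hnU⟩

theorem IsCadlag.comp_continuous {E F : Type*} [TopologicalSpace E] [TopologicalSpace F] {x : I → E}
    (hx : IsCadlag x) {g : E → F} (hg : Continuous g) : IsCadlag fun t => g (x t) := fun t =>
  ⟨(hg.tendsto _).comp (hx t).1, (hx t).2.imp' g fun l hl => (hg.tendsto l).comp hl⟩

theorem IsCaglad.comp_continuous {E F : Type*} [TopologicalSpace E] [TopologicalSpace F] {x : I → E}
    (hx : IsCaglad x) {g : E → F} (hg : Continuous g) : IsCaglad fun t => g (x t) := fun t =>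
  ⟨(hg.tendsto _).comp (hx t).1, (hx t).2.imp' g fun l hl => (hg.tendsto l).comp hl⟩

/-- Continuity on a set can be tested after composition with `arctan`, an embedding of `ℝ` onto a
bounded interval. -/
theorem continuousOn_of_arctan_comp {X : Type*} [TopologicalSpace X] {f : X → ℝ} {s : Set X}
    (h : ContinuousOn (fun x => Real.arctan (f x)) s) : ContinuousOn f s := by
  refine (Real.continuousOn_tan.comp h fun x _ => (Real.cos_arctan_pos (f x)).ne').congr
    fun x _ => (Real.tan_arctan (f x)).symm

/-- A measurable function that is almost surely càdlàg along the paths, and càglàd along their left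
limits, is quasi continuous. -/
theorem quasiContinuous_of_ae_isCadlag (hS : IsCoSouslin S) [I.OrdConnected]
    (hIc : IsClosed I) (hI0 : I ⊆ Ici 0) {f : I × S → ℝ} (hf : Measurable f)
    {P : Measure (SkorohodSpace I S)} [IsFiniteMeasure P]
    (hcad : ∀ᵐ ω ∂P, IsCadlag fun t : I => f (t, ω t))
    (hcag : ∀ᵐ ω : SkorohodSpace I S ∂P,
      IsCaglad fun t : I => f (t, Function.leftLim (ω : I → S) t)) :
    QuasiContinuous P f := by
  have hex : ∀ n : ℕ, ∃ K : Set (I × S), IsCompact K ∧ ContinuousOn f K ∧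
      P {ω | ∃ s : I, (s : ℝ) ≤ n ∧ (s, ω s) ∉ K} < ((n : ℝ≥0∞) + 1)⁻¹ := by
    intro n
    obtain ⟨K, hK, hc, hP⟩ := exists_isCompact_continuousOn_measure_lt hS hIc hI0
      (Real.continuous_arctan.measurable.comp hf) (C := Real.pi / 2)
      (fun p => abs_le.2 ⟨(Real.neg_pi_div_two_lt_arctan _).le, (Real.arctan_lt_pi_div_two _).le⟩)
      (hcad.mono fun ω h => h.comp_continuous Real.continuous_arctan)
      (hcag.mono fun ω h => h.comp_continuous Real.continuous_arctan) n
      (ε := ((n : ℝ≥0∞) + 1)⁻¹) (ENNReal.inv_pos.2 (by finiteness))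
    exact ⟨K, hK, continuousOn_of_arctan_comp hc, hP⟩
  choose K hK hc hP using hex
  have hsucc : ∀ n, ⋃ i ≤ n + 1, K i = (⋃ i ≤ n, K i) ∪ K (n + 1) := biUnion_le_succ K
  have hcomp : ∀ n, IsCompact (⋃ i ≤ n, K i) := fun n =>
    (finite_Iic n).isCompact_biUnion fun i _ => hK i
  refine ⟨fun n => ⋃ i ≤ n, K i, fun m n hmn => biUnion_mono (fun i (hi : i ≤ m) => hi.trans hmn)
    fun _ _ => Subset.rfl, hcomp, ?_, fun n => ?_⟩
  · have hlim : Tendsto (fun n : ℕ => ((n : ℝ≥0∞) + 1)⁻¹) atTop (𝓝 0) := by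
      simpa [Function.comp_def] using ENNReal.tendsto_inv_nat_nhds_zero.comp (tendsto_add_atTop_nat 1)
    refine tendsto_of_tendsto_of_tendsto_of_le_of_le tendsto_const_nhds hlim
      (fun _ => zero_le) fun n => le_trans (measure_mono ?_) (hP n).le
    rintro ω ⟨s, hs, hns⟩
    exact ⟨s, hs, fun h => hns (mem_biUnion (le_refl n) h)⟩
  · induction n with
    | zero => simpa using hc 0
    | succ n ih =>
      change ContinuousOn f (⋃ i ≤ n + 1, K i)
      rw [hsucc]
      exact ih.union_of_isClosed (hc (n + 1)) (hcomp n).isClosed (hK (n + 1)).isClosed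

end

/-- The time set `I` is `[0, ∞)` or `[0, T]`; `Function.leftLim ω t` is the left limit of the path
`ω` at `t` (and `ω 0` at `t = 0`). -/
theorem proposition7p4 {S : Type*} [MetricSpace S] [MeasurableSpace S] [BorelSpace S]
    (hS : IsCoSouslin S) (I : Set ℝ) (hI : I = Ici 0 ∨ ∃ T : ℝ, 0 < T ∧ I = Icc 0 T)
    (f : I × S → ℝ) (hf : Measurable f)
    (P : Measure (SkorohodSpace I S)) [IsProbabilityMeasure P] :
    QuasiContinuous P f ↔
      (∀ᵐ ω ∂P, IsCadlag fun t : I => f (t, ω t)) ∧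
        (∀ᵐ ω : SkorohodSpace I S ∂P, IsCaglad fun t : I => f (t, Function.leftLim (ω : I → S) t)) := by
  have hord : I.OrdConnected := by
    rcases hI with rfl | ⟨T, -, rfl⟩
    exacts [ordConnected_Ici, ordConnected_Icc]
  have hIc : IsClosed I := by
    rcases hI with rfl | ⟨T, -, rfl⟩
    exacts [isClosed_Ici, isClosed_Icc]
  have hI0 : I ⊆ Ici 0 := by
    rcases hI with rfl | ⟨T, -, rfl⟩
    exacts [Subset.rfl, Icc_subset_Ici_self]
  exact ⟨fun h => eventually_and.1 h.ae_isCadlag_and_isCaglad,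
    fun h => quasiContinuous_of_ae_isCadlag hS hIc hI0 hf h.1 h.2⟩
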